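/- **Conventions.** For a group $G$, a subset $S\subseteq G$ and $x\in G$, the length $|x|_S$ is the least $k\ge 0$ such that $x$ is a product of $k$ elements of $S\cup S^{-1}$ ($\infty$ if there is none), and the width of $G$ relative to $S$ is $\operatorname{wid}(G,S)=\sup_{x\in G}|x|_S\in\mathbf N\cup\{\infty\}$. The group $G$ is *of universally finite width* if $\operatorname{wid}(G,S)<\infty$ for every generating set $S$ of $G$. Let $\mathbf V$ be a variety of (finitary, one-sorted) algebras, and let $F\in\mathbf V$ be a free algebra of infinite rank, i.e. one with an infinite free basis. A subalgebra $U$ of $F$ is *moietous* if $U$ is generated by a subset $J$ of some infinite free basis $B$ of $F$ with $|J|=|B\setminus J|$. We write $F=U_1*U_2*W$ if $F$ is the free product (coproduct in $\mathbf V$) of its subalgebras $U_1,U_2,W$; then $U_i*W$ denotes the subalgebra generated by $U_i\cup W$. For $G=\operatorname{Aut}(F)$ and subalgebras $A,C$ of $F$, let $G_{(A),\{C\}}$ be the subgroup of all $\sigma\in G$ that fix $A$ pointwise and satisfy $\sigma(C)=C$. The variety $\mathbf V$ is a *BMN-variety* if for every free algebra $F\in\mathbf V$ of infinite rank and all moietous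 subalgebras $U_1,U_2,W$ of $F$ with $F=U_1*U_2*W$, the group $G=\operatorname{Aut}(F)$ is generated by the subgroups $G_{(U_2),\{U_1*W\}}$ and $G_{(U_1),\{U_2*W\}}$. **Theorem.** Let $\mathbf V$ be a BMN-variety, let $F\in\mathbf V$ be a free algebra of infinite rank, and let $G=\operatorname{Aut}(F)$. Then $G$ is a group of universally finite width if and only if there are moietous subalgebras $U_1,U_2,W$ of $F$ with $F=U_1*U_2*W$ such that $$\operatorname{wid}\bigl(G,\;G_{(U_2),\{U_1*W\}}\cup G_{(U_1),\{U_2*W\}}\bigr)<\infty .$$ Moreover, for each choice of moietous subalgebras $U_1,U_2,W$ of $F$ with $F=U_1*U_2*W$, the group $G$ is of universally finite width if and only if this width is finite. -/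

import Mathlib

open scoped FirstOrder
open scoped Pointwise

universe u v w

namespace BMN

section Width

variable {G : Type*} [Group G]

/-- The length of `x` relative to `S`: the least number of factors in an expression of `x` as a
product of elements of `S ∪ S⁻¹` (`⊤` if there is no such expression; the identity has
length `0`, being the empty product). -/
noncomputable def length (S : Set G) (x : G) : ℕ∞ :=
  ⨅ (l : List G) (_ : (∀ y ∈ l, y ∈ S ∪ S⁻¹) ∧ l.prod = x), (l.length : ℕ∞)

/-- The width of `G` relative to `S`: the supremum of the lengths of the elements of `G`. -/
noncomputable def width (S : Set G) : ℕ∞ :=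
  ⨆ x : G, length S x

variable (G) in
/-- `G` is of universally finite width: its width relative to every generating set is finite. -/
def UniversallyFiniteWidth : Prop :=
  ∀ S : Set G, Subgroup.closure S = ⊤ → width S ≠ ⊤

end Width

section Aut

variable {L : FirstOrder.Language.{u, v}} {F : Type w} [L.Structure F]

/-- The automorphism group of an algebra; `(σ * τ) x = σ (τ x)`. -/
instance autGroup : Group (F ≃[L] F) where
  mul σ τ := σ.comp τ
  one := FirstOrder.Language.Equiv.refl L F
  inv σ := σ.symm
  mul_assoc _ _ _ := rfl
  one_mul _ := rfl
  mul_one _ := rfl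
  inv_mul_cancel σ := FirstOrder.Language.Equiv.symm_comp_self σ

/-- The natural action of the automorphism group; `σ • x = σ x`. -/
instance autMulAction : MulAction (F ≃[L] F) F where
  smul σ x := σ x
  one_smul _ := rfl
  mul_smul _ _ _ := rfl

/-- For subalgebras `A`, `B`, the subgroup of all automorphisms that fix `A` pointwise and fix
`B` setwise. -/
def fixStab (A B : L.Substructure F) : Subgroup (F ≃[L] F) :=
  fixingSubgroup (F ≃[L] F) (A : Set F) ⊓ MulAction.stabilizer (F ≃[L] F) (B : Set F)

end Aut

section Variety

variable {L : FirstOrder.Language.{u, v}}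

/-- A set of identities `s ≈ t` in the variables `x₀, x₁, …`. With `L` having operation symbols
only, the algebras satisfying it form a variety, and every variety is of this form. -/
abbrev Identities (L : FirstOrder.Language.{u, v}) : Type u :=
  Set (L.Term ℕ × L.Term ℕ)

/-- The algebra `M` belongs to the variety defined by `E`. -/
def InVariety (E : Identities L) (M : Type*) [L.Structure M] : Prop :=
  ∀ e ∈ E, ∀ x : ℕ → M, e.1.realize x = e.2.realize x

/-- `F` is a free algebra of the variety defined by `E`, with free basis `B`. The universe of the
test algebras `M` is large enough to contain the term model of a free algebra on `B`. -/
def IsBasis (E : Identities L) {F : Type w} [L.Structure F] (B : Set F) : Prop :=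
  InVariety E F ∧
    ∀ (M : Type (max u w)) [L.Structure M], InVariety E M →
      ∀ f : B → M, ∃! g : F →[L] M, ∀ b : B, g b = f b

/-- `F` is a free algebra of infinite rank of the variety defined by `E`. -/
def IsFreeOfInfiniteRank (E : Identities L) (F : Type w) [L.Structure F] : Prop :=
  ∃ B : Set F, IsBasis E B ∧ B.Infinite

/-- A subalgebra is moietous if it is generated by a moiety `J` of an infinite free basis `B`,
that is, by a subset `J` of `B` with `|J| = |B \ J|`. -/
def IsMoietous (E : Identities L) {F : Type w} [L.Structure F] (U : L.Substructure F) : Prop :=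
  ∃ B : Set F, IsBasis E B ∧ B.Infinite ∧
    ∃ J ⊆ B, Cardinal.mk J = Cardinal.mk (B \ J : Set F) ∧ U = FirstOrder.Language.Substructure.closure L J

/-- `F` is the (internal) free product `U₁ * U₂ * W` of its subalgebras, that is, their coproduct
in the variety defined by `E`. -/
def IsFreeProduct (E : Identities L) {F : Type w} [L.Structure F]
    (U₁ U₂ W : L.Substructure F) : Prop :=
  InVariety E F ∧
    ∀ (M : Type (max u w)) [L.Structure M], InVariety E M →
      ∀ (f₁ : U₁ →[L] M) (f₂ : U₂ →[L] M) (f₃ : W →[L] M),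
        ∃! g : F →[L] M, (∀ x : U₁, g x = f₁ x) ∧ (∀ x : U₂, g x = f₂ x) ∧ (∀ x : W, g x = f₃ x)

/-- `U₁`, `U₂`, `W` are moietous subalgebras of `F` and `F = U₁ * U₂ * W`. -/
def IsMoietousFactorization (E : Identities L) {F : Type w} [L.Structure F]
    (U₁ U₂ W : L.Substructure F) : Prop :=
  IsMoietous E U₁ ∧ IsMoietous E U₂ ∧ IsMoietous E W ∧ IsFreeProduct E U₁ U₂ W

/-- The union of the subgroups `G_{(U₂),{U₁ * W}}` and `G_{(U₁),{U₂ * W}}` of `G = Aut F`; here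
`U₁ * W` and `U₂ * W` are the subalgebras of `F` generated by the two factors. -/
def macphersonSet {F : Type w} [L.Structure F] (U₁ U₂ W : L.Substructure F) : Set (F ≃[L] F) :=
  (fixStab U₂ (U₁ ⊔ W) : Set (F ≃[L] F)) ∪ (fixStab U₁ (U₂ ⊔ W) : Set (F ≃[L] F))

/-- The variety defined by `E` is a BMN-variety (for its algebras with carrier in `Type w`). -/
def IsBMNVariety (E : Identities L) : Prop :=
  ∀ (F : Type w) [L.Structure F], IsFreeOfInfiniteRank E F →
    ∀ U₁ U₂ W : L.Substructure F, IsMoietousFactorization E U₁ U₂ W →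
      Subgroup.closure (macphersonSet U₁ U₂ W) = ⊤

end Variety

end BMN

/-!
Let `S` generate `Aut F`, and split a basis of `F` into blocks, indexed by `ℕ`, of full size. A
diagonal argument yields a block `n` such that every automorphism supported on it agrees there with
one of length at most `n` that stabilizes the subalgebra generated by the other blocks. Split this
block further into layers indexed by `ℤ`, and let `ρ` shift the layers. By an Eilenberg swindle
every automorphism supported on the layer `0` is a commutator `α ρ α⁻¹ ρ⁻¹` with `α` supported on
the block; since `ρ` commutes with everything supported off the block, `α` may be replaced by an
element of length at most `n`. So the automorphisms supported on that layer have bounded length,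
and hence so do those supported on any moiety of a basis, because all moieties are conjugate. The
automorphisms in `G_{(U₂),{U₁ * W}}` and `G_{(U₁),{U₂ * W}}` are supported on moieties.
-/

namespace BMN

open FirstOrder.Language FirstOrder.Language.Substructure
open scoped Cardinal

section Width

variable {G : Type*} [Group G] {S T X : Set G} {x : G}

theorem length_le_natCast_iff {n : ℕ} :
    length S x ≤ n ↔ ∃ l : List G, (∀ y ∈ l, y ∈ S ∪ S⁻¹) ∧ l.prod = x ∧ l.length ≤ n := by
  have lt_succ_iff (m : ℕ∞) : m < n + 1 ↔ m ≤ n := ENat.lt_add_one_iff (ENat.natCast_ne_top n)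
  rw [← lt_succ_iff, length]
  simp only [iInf_lt_iff, exists_prop]
  simp only [lt_succ_iff, Nat.cast_le, and_assoc]

theorem length_le_natCast_iff_mem_pow {n : ℕ} :
    length S x ≤ n ↔ x ∈ (insert 1 (S ∪ S⁻¹)) ^ n := by
  rw [length_le_natCast_iff]
  constructor
  · rintro ⟨l, hl, rfl, hn⟩
    refine Set.pow_subset_pow_right (Set.mem_insert 1 _) hn ?_
    clear hn
    induction l with
    | nil => simp
    | cons y l ih =>
      obtain ⟨hy, hl⟩ := List.forall_mem_cons.1 hl
      rw [List.prod_cons, List.length_cons, pow_succ']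
      exact Set.mul_mem_mul (Set.mem_insert_of_mem 1 hy) (ih hl)
  · intro hx
    induction n generalizing x with
    | zero => exact ⟨[], by simp, by simpa using hx.symm, le_rfl⟩
    | succ n ih =>
      obtain ⟨y, hy, z, hz, rfl⟩ := Set.mem_mul.1 (pow_succ' (insert 1 (S ∪ S⁻¹)) n ▸ hx)
      obtain ⟨l, hl, rfl, hn⟩ := ih hz
      rcases hy with rfl | hy
      · exact ⟨l, hl, (one_mul _).symm, hn.trans n.le_succ⟩
      · exact ⟨y :: l, List.forall_mem_cons.2 ⟨hy, hl⟩, List.prod_cons, Nat.succ_le_succ hn⟩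

theorem exists_length_le (hS : Subgroup.closure S = ⊤) (x : G) : ∃ n : ℕ, length S x ≤ n := by
  have hx : x ∈ (Subgroup.closure S).toSubmonoid := hS ▸ Subgroup.mem_top x
  rw [Subgroup.closure_toSubmonoid] at hx
  obtain ⟨l, hl, rfl⟩ := Submonoid.exists_list_of_mem_closure hx
  exact ⟨l.length, length_le_natCast_iff.2 ⟨l, hl, rfl, le_rfl⟩⟩

/-- The elements of `T` have bounded length relative to `S`. The whole group has bounded length
exactly if its width is finite, and subsets of bounded length are closed under finite unions,
products, inverses and change of the generating set, which is how widths are compared. -/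
def HasBoundedLength (S T : Set G) : Prop :=
  ∃ n : ℕ, ∀ x ∈ T, length S x ≤ n

theorem hasBoundedLength_iff_subset_pow :
    HasBoundedLength S T ↔ ∃ n : ℕ, T ⊆ (insert 1 (S ∪ S⁻¹)) ^ n := by
  simp only [HasBoundedLength, length_le_natCast_iff_mem_pow, Set.subset_def]

theorem width_ne_top_iff_hasBoundedLength : width S ≠ ⊤ ↔ HasBoundedLength S Set.univ := by
  constructor
  · intro h
    obtain ⟨n, hn⟩ := ENat.ne_top_iff_exists.1 h
    exact ⟨n, fun x _ => hn ▸ le_iSup (length S) x⟩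
  · rintro ⟨n, hn⟩
    exact ne_top_of_le_ne_top (ENat.natCast_ne_top n) (iSup_le fun x => hn x (Set.mem_univ x))

theorem inv_insert_one_union_inv (S : Set G) :
    (insert 1 (S ∪ S⁻¹))⁻¹ = insert 1 (S ∪ S⁻¹) := by
  rw [Set.inv_insert, inv_one, Set.union_inv, inv_inv, Set.union_comm]

theorem closure_eq_top_of_width_ne_top (hS : width S ≠ ⊤) : Subgroup.closure S = ⊤ := by
  obtain ⟨n, hn⟩ := width_ne_top_iff_hasBoundedLength.1 hS
  refine (Subgroup.eq_top_iff' _).2 fun x => ?_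
  obtain ⟨l, hl, rfl, -⟩ := length_le_natCast_iff.1 (hn x (Set.mem_univ x))
  refine list_prod_mem fun y hy => (hl y hy).elim (Subgroup.subset_closure ·) fun h => ?_
  exact inv_mem_iff.1 (Subgroup.subset_closure h)

namespace HasBoundedLength

theorem mono (hT : HasBoundedLength S T) (h : X ⊆ T) : HasBoundedLength S X :=
  hT.imp fun _ hn x hx => hn x (h hx)

theorem singleton (hS : Subgroup.closure S = ⊤) (x : G) : HasBoundedLength S {x} :=
  (exists_length_le hS x).imp fun _ hn => by simpa using hn

theorem union (hT : HasBoundedLength S T) (hX : HasBoundedLength S X) :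
    HasBoundedLength S (T ∪ X) := by
  obtain ⟨m, hm⟩ := hT
  obtain ⟨n, hn⟩ := hX
  refine ⟨max m n, fun x hx => ?_⟩
  rcases hx with hx | hx
  · exact (hm x hx).trans (Nat.cast_le.2 (le_max_left m n))
  · exact (hn x hx).trans (Nat.cast_le.2 (le_max_right m n))

theorem mul (hT : HasBoundedLength S T) (hX : HasBoundedLength S X) :
    HasBoundedLength S (T * X) := by
  rw [hasBoundedLength_iff_subset_pow] at *
  obtain ⟨m, hm⟩ := hT
  obtain ⟨n, hn⟩ := hX
  exact ⟨m + n, pow_add (insert 1 (S ∪ S⁻¹)) m n ▸ Set.mul_subset_mul hm hn⟩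

theorem inv (hT : HasBoundedLength S T) : HasBoundedLength S T⁻¹ := by
  rw [hasBoundedLength_iff_subset_pow] at *
  obtain ⟨n, hn⟩ := hT
  refine ⟨n, ?_⟩
  rw [← inv_insert_one_union_inv S, inv_pow]
  exact Set.inv_subset_inv.2 hn

theorem trans (hX : HasBoundedLength T X) (hT : HasBoundedLength S T) : HasBoundedLength S X := by
  have hT' : HasBoundedLength S (insert 1 (T ∪ T⁻¹)) :=
    union ⟨0, fun _ hx => length_le_natCast_iff.2 ⟨[], by simp, hx.symm, le_rfl⟩⟩
      (hT.union hT.inv)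
  rw [hasBoundedLength_iff_subset_pow] at *
  obtain ⟨m, hm⟩ := hT'
  obtain ⟨n, hn⟩ := hX
  exact ⟨m * n, pow_mul (insert 1 (S ∪ S⁻¹)) m n ▸ hn.trans (Set.pow_subset_pow_left hm)⟩

end HasBoundedLength

end Width

section Automorphisms

variable {L : FirstOrder.Language.{u, v}} {F : Type w} [L.Structure F]

theorem aut_mul_apply (σ τ : F ≃[L] F) (x : F) : (σ * τ) x = σ (τ x) := rfl

theorem aut_inv_apply_self (σ : F ≃[L] F) (x : F) : σ⁻¹ (σ x) = x := σ.symm_apply_apply x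

theorem aut_apply_inv_self (σ : F ≃[L] F) (x : F) : σ (σ⁻¹ x) = x := σ.apply_symm_apply x

theorem map_aut_mul (A : L.Substructure F) (σ τ : F ≃[L] F) :
    A.map (σ * τ).toHom = (A.map τ.toHom).map σ.toHom :=
  (A.map_map σ.toHom τ.toHom).symm

theorem map_aut_inv_eq_iff {A B : L.Substructure F} {σ : F ≃[L] F} :
    B.map σ⁻¹.toHom = A ↔ A.map σ.toHom = B := by
  constructor
  · rintro rfl
    rw [← map_aut_mul, mul_inv_cancel]
    exact map_id B
  · rintro rfl
    rw [← map_aut_mul, inv_mul_cancel]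
    exact map_id A

theorem map_aut_eq_self_of_forall_apply_eq {A : L.Substructure F} {σ : F ≃[L] F}
    (h : ∀ x ∈ A, σ x = x) : A.map σ.toHom = A :=
  SetLike.coe_injective ((Set.image_congr h).trans (Set.image_id' _))

theorem mem_fixStab_iff {A B : L.Substructure F} {σ : F ≃[L] F} :
    σ ∈ fixStab A B ↔ (∀ x ∈ A, σ x = x) ∧ B.map σ.toHom = B :=
  Iff.and (mem_fixingSubgroup_iff _) (SetLike.coe_set_eq (p := B.map σ.toHom))

theorem conj_mem_fixStab {A B : L.Substructure F} {σ : F ≃[L] F} (δ : F ≃[L] F)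
    (hσ : σ ∈ fixStab A B) : δ * σ * δ⁻¹ ∈ fixStab (A.map δ.toHom) (B.map δ.toHom) := by
  obtain ⟨hfix, hmap⟩ := mem_fixStab_iff.1 hσ
  refine mem_fixStab_iff.2 ⟨?_, ?_⟩
  · rintro _ ⟨x, hx, rfl⟩
    exact congrArg δ ((congrArg σ (aut_inv_apply_self δ x)).trans (hfix x hx))
  · rw [map_aut_mul, map_aut_mul, map_aut_inv_eq_iff.2 rfl, hmap]

theorem aut_ext_of_closure_eq_top {s : Set F} (hs : closure L s = ⊤) {σ τ : F ≃[L] F}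
    (h : ∀ x ∈ s, σ x = τ x) : σ = τ :=
  DFunLike.ext _ _ fun x =>
    DFunLike.congr_fun (Hom.eq_of_eqOn_dense (f := σ.toHom) (g := τ.toHom) hs h) x

theorem commute_of_mem_fixStab {A B : L.Substructure F} (hAB : A ⊔ B = ⊤) {σ τ : F ≃[L] F}
    (hσ : σ ∈ fixStab A B) (hτ : τ ∈ fixStab B A) : Commute σ τ := by
  obtain ⟨hσA, hσB⟩ := mem_fixStab_iff.1 hσ
  obtain ⟨hτB, hτA⟩ := mem_fixStab_iff.1 hτ
  have hgen : closure L (A ∪ B : Set F) = ⊤ := by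
    rw [Substructure.closure_union, Substructure.closure_eq, Substructure.closure_eq, hAB]
  refine aut_ext_of_closure_eq_top hgen ?_
  rintro x (hx | hx)
  · have hτx : τ x ∈ A := hτA.le (mem_map_of_mem τ.toHom hx)
    rw [aut_mul_apply, aut_mul_apply, hσA x hx, hσA _ hτx]
  · have hσx : σ x ∈ B := hσB.le (mem_map_of_mem σ.toHom hx)
    rw [aut_mul_apply, aut_mul_apply, hτB x hx, hτB _ hσx]

end Automorphisms

section Span

variable {L : FirstOrder.Language.{u, v}} {F M : Type*} [L.Structure F] [L.Structure M]
  {ι κ : Type*} {b : ι → F} {T T' : Set ι}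

variable (L b T) in
/-- The subalgebra generated by the members of the family `b` with index in `T`. -/
def span : L.Substructure F :=
  closure L (b '' T)

theorem mem_span {i : ι} (hi : i ∈ T) : b i ∈ span L b T :=
  subset_closure (Set.mem_image_of_mem b hi)

theorem span_mono (h : T ⊆ T') : span L b T ≤ span L b T' :=
  closure_mono (Set.image_mono h)

theorem span_univ : span L b Set.univ = closure L (Set.range b) := by
  rw [span, Set.image_univ]

theorem span_union : span L b (T ∪ T') = span L b T ⊔ span L b T' := by
  rw [span, Set.image_union, Substructure.closure_union, span, span]

theorem span_preimage_eq_iSup (p : ι → κ) (A : Set κ) :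
    span L b (p ⁻¹' A) = ⨆ k : A, span L b (p ⁻¹' {k.1}) := by
  simp only [span, ← Substructure.closure_iUnion, ← Set.image_iUnion, ← Set.preimage_iUnion,
    Set.iUnion_coe_set, Set.biUnion_of_singleton]

theorem span_comp (e : κ → ι) (T : Set κ) : span L (b ∘ e) T = span L b (e '' T) := by
  rw [span, span, Set.image_comp]

theorem map_span (g : F →[L] M) (T : Set ι) : (span L b T).map g = span L (g ∘ b) T := by
  rw [span, span, map_closure, Set.image_comp]

theorem span_congr {c : ι → F} (h : ∀ i ∈ T, b i = c i) : span L b T = span L c T :=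
  congrArg (Substructure.closure L) (Set.image_congr h)

theorem eqOn_span {g h : F →[L] M} (H : ∀ i ∈ T, g (b i) = h (b i)) :
    Set.EqOn g h (span L b T) :=
  Hom.eqOn_closure (Set.forall_mem_image.2 H)

theorem exists_finset_mem_span {x : F} (hx : x ∈ closure L (Set.range b)) :
    ∃ s : Finset ι, x ∈ span L b s := by
  classical
  refine closure_induction hx ?_ ?_
  · intro n f y hy
    choose s hs using hy
    refine ⟨Finset.univ.biUnion s, fun_mem _ f y fun i => ?_⟩
    exact span_mono (fun j hj => by simpa using ⟨i, hj⟩) (hs i)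
  · rintro _ ⟨i, rfl⟩
    exact ⟨{i}, mem_span (by simp)⟩

variable (L b T) in
/-- The automorphisms supported by the factor with basis indexed by `T`: they fix the members of
the family `b` with index outside `T` and stabilize the subalgebra generated by the others. -/
def supportedOn : Subgroup (F ≃[L] F) :=
  fixStab (span L b Tᶜ) (span L b T)

theorem mem_supportedOn_iff {σ : F ≃[L] F} :
    σ ∈ supportedOn L b T ↔
      (∀ i ∉ T, σ (b i) = b i) ∧ (span L b T).map σ.toHom = span L b T := by
  rw [supportedOn, mem_fixStab_iff]
  exact and_congr_left' ⟨fun h i hi => h _ (mem_span hi),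
    fun h x hx => eqOn_span (g := σ.toHom) (h := Hom.id L F) h hx⟩

theorem supportedOn_comp (e : κ ≃ ι) (T : Set κ) :
    supportedOn L (b ∘ e) T = supportedOn L b (e '' T) := by
  rw [supportedOn, supportedOn, span_comp, span_comp, Set.image_compl_eq e.bijective]

theorem map_span_compl_of_mem_supportedOn {σ : F ≃[L] F} (hσ : σ ∈ supportedOn L b T) :
    (span L b Tᶜ).map σ.toHom = span L b Tᶜ :=
  map_aut_eq_self_of_forall_apply_eq (mem_fixStab_iff.1 hσ).1

end Span

section FreeFamily

variable {L : FirstOrder.Language.{u, v}} {F : Type*} [L.Structure F] {ι κ : Type*} {b c : ι → F}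

variable (L b) in
/-- The family `b` is independent in the algebra `F`: every family of elements of `F` with the
same index type is the image of `b` under some endomorphism of `F`. -/
def IsIndependent : Prop :=
  ∀ f : ι → F, ∃ g : F →[L] F, ∀ i, g (b i) = f i

variable (L b) in
/-- The family `b` is a free basis of `F`, where freeness is tested on `F` itself only. This
depends on no variety and is all that is needed to construct automorphisms of `F`. -/
structure IsFreeFamily : Prop where
  closure_range_eq_top : Substructure.closure L (Set.range b) = ⊤
  isIndependent : IsIndependent L b

theorem IsIndependent.comp (hb : IsIndependent L b) {e : κ → ι} (he : Function.Injective e) :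
    IsIndependent L (b ∘ e) := fun f => by
  obtain ⟨g, hg⟩ := hb (Function.extend e f b)
  exact ⟨g, fun k => (hg (e k)).trans (he.extend_apply f b k)⟩

namespace IsFreeFamily

theorem comp_equiv (hb : IsFreeFamily L b) (e : κ ≃ ι) : IsFreeFamily L (b ∘ e) where
  closure_range_eq_top := by rw [e.surjective.range_comp, hb.closure_range_eq_top]
  isIndependent := hb.isIndependent.comp e.injective

theorem hom_ext (hb : IsFreeFamily L b) {g h : F →[L] F} (H : ∀ i, g (b i) = h (b i)) : g = h :=
  Hom.eq_of_eqOn_dense hb.closure_range_eq_top (Set.forall_mem_range.2 H)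

theorem aut_ext (hb : IsFreeFamily L b) {σ τ : F ≃[L] F} (H : ∀ i, σ (b i) = τ (b i)) : σ = τ :=
  aut_ext_of_closure_eq_top hb.closure_range_eq_top (Set.forall_mem_range.2 H)

theorem exists_aut (hb : IsFreeFamily L b) (hc : IsFreeFamily L c) :
    ∃ σ : F ≃[L] F, ∀ i, σ (b i) = c i := by
  obtain ⟨φ, hφ⟩ := hb.isIndependent c
  obtain ⟨ψ, hψ⟩ := hc.isIndependent b
  have hψφ : ψ.comp φ = Hom.id L F := hb.hom_ext fun i => by
    rw [Hom.comp_apply, hφ, hψ, Hom.id_apply]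
  have hφψ : φ.comp ψ = Hom.id L F := hc.hom_ext fun i => by
    rw [Hom.comp_apply, hψ, hφ, Hom.id_apply]
  refine ⟨⟨⟨φ, ψ, DFunLike.congr_fun hψφ, DFunLike.congr_fun hφψ⟩, φ.map_fun, fun r x => ?_⟩, hφ⟩
  refine ⟨fun hx => ?_, φ.map_rel r x⟩
  have hx' := ψ.map_rel r _ hx
  rwa [← Function.comp_assoc, show ψ ∘ φ = id from congrArg DFunLike.coe hψφ] at hx'

theorem exists_aut_perm (hb : IsFreeFamily L b) (π : Equiv.Perm ι) :
    ∃ σ : F ≃[L] F, ∀ i, σ (b i) = b (π i) :=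
  hb.exists_aut (hb.comp_equiv π)

theorem span_sup_span_compl (hb : IsFreeFamily L b) (T : Set ι) :
    span L b T ⊔ span L b Tᶜ = ⊤ := by
  rw [← span_union, Set.union_compl_self, span_univ, hb.closure_range_eq_top]

theorem commute_of_mem_supportedOn (hb : IsFreeFamily L b) {T : Set ι} {σ τ : F ≃[L] F}
    (hσ : σ ∈ supportedOn L b T) (hτ : τ ∈ supportedOn L b Tᶜ) : Commute σ τ := by
  rw [supportedOn, compl_compl] at hτ
  exact commute_of_mem_fixStab (sup_comm (span L b T) _ ▸ hb.span_sup_span_compl T) hσ hτ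

end IsFreeFamily

section Glue

variable {p : ι → κ} {τ : κ → F ≃[L] F}

theorem span_preimage_of_map_span_eq
    (hτ : ∀ k, (span L b (p ⁻¹' {k})).map (τ k).toHom = span L b (p ⁻¹' {k})) (A : Set κ) :
    span L (fun i => τ (p i) (b i)) (p ⁻¹' A) = span L b (p ⁻¹' A) := by
  have hblock (k : κ) :
      span L (fun i => τ (p i) (b i)) (p ⁻¹' {k}) = span L b (p ⁻¹' {k}) := by
    conv_rhs => rw [← hτ k, map_span]
    refine span_congr ?_
    rintro i rfl
    rfl
  rw [span_preimage_eq_iSup, span_preimage_eq_iSup, iSup_congr fun k : A => hblock k]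

theorem IsFreeFamily.glue (hb : IsFreeFamily L b)
    (hτ : ∀ k, (span L b (p ⁻¹' {k})).map (τ k).toHom = span L b (p ⁻¹' {k})) :
    IsFreeFamily L (fun i => τ (p i) (b i)) where
  closure_range_eq_top := by
    rw [← span_univ, ← Set.preimage_univ (f := p), span_preimage_of_map_span_eq hτ,
      Set.preimage_univ, span_univ, hb.closure_range_eq_top]
  isIndependent f := by
    obtain ⟨h, hh⟩ := hb.isIndependent f
    obtain ⟨g, hg⟩ := hb.isIndependent fun i => h ((τ (p i))⁻¹ (b i))
    have hgh (k : κ) : Set.EqOn g (h.comp (τ k)⁻¹.toHom) (span L b (p ⁻¹' {k})) := by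
      refine eqOn_span ?_
      rintro i rfl
      exact hg i
    refine ⟨g, fun i => ?_⟩
    have hmem : τ (p i) (b i) ∈ span L b (p ⁻¹' {p i}) :=
      (hτ (p i)).le (mem_map_of_mem (τ (p i)).toHom (mem_span rfl))
    calc g (τ (p i) (b i)) = h ((τ (p i))⁻¹ (τ (p i) (b i))) := hgh (p i) hmem
      _ = f i := by rw [aut_inv_apply_self, hh]

theorem IsFreeFamily.exists_aut_glue (hb : IsFreeFamily L b)
    (hτ : ∀ k, (span L b (p ⁻¹' {k})).map (τ k).toHom = span L b (p ⁻¹' {k})) :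
    ∃ σ : F ≃[L] F, (∀ k, ∀ x ∈ span L b (p ⁻¹' {k}), σ x = τ k x) ∧
      ∀ A : Set κ, (span L b (p ⁻¹' A)).map σ.toHom = span L b (p ⁻¹' A) := by
  obtain ⟨σ, hσ⟩ := hb.exists_aut (hb.glue hτ)
  refine ⟨σ, fun k x hx => ?_, fun A => ?_⟩
  · refine eqOn_span (g := σ.toHom) (h := (τ k).toHom) ?_ hx
    rintro i rfl
    exact hσ i
  · rw [map_span, ← span_preimage_of_map_span_eq hτ A]
    exact span_congr fun i _ => hσ i

end Glue

-- A diagonal argument: otherwise glue counterexamples, one for each block, and consider the block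
-- whose index is the length of the resulting automorphism.
theorem IsFreeFamily.exists_forall_mem_supportedOn_exists_length_le (hb : IsFreeFamily L b)
    (p : ι → ℕ) {S : Set (F ≃[L] F)} (hS : Subgroup.closure S = ⊤) :
    ∃ n : ℕ, ∀ τ ∈ supportedOn L b (p ⁻¹' {n}),
      ∃ s, length S s ≤ n ∧ τ⁻¹ * s ∈ supportedOn L b (p ⁻¹' {n})ᶜ := by
  by_contra! h
  choose τ hτ hlength using h
  obtain ⟨σ, hστ, hσ⟩ := hb.exists_aut_glue fun n => (mem_supportedOn_iff.1 (hτ n)).2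
  obtain ⟨n, hn⟩ := exists_length_le hS σ
  refine hlength n σ hn (mem_supportedOn_iff.2 ⟨fun i hi => ?_, ?_⟩)
  · rw [aut_mul_apply, hστ n _ (mem_span (Set.notMem_compl_iff.1 hi)), aut_inv_apply_self]
  · rw [map_aut_mul, ← Set.preimage_compl, hσ, map_aut_inv_eq_iff, Set.preimage_compl]
    exact map_span_compl_of_mem_supportedOn (hτ n)

end FreeFamily

section Swindle

variable {L : FirstOrder.Language.{u, v}} {F : Type*} [L.Structure F] {ι : Type*} {b : ι → F}

theorem map_aut_zpow {X : ℤ → L.Substructure F} {ρ : F ≃[L] F}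
    (hρ : ∀ j, (X j).map ρ.toHom = X (j + 1)) (j : ℤ) : (X 0).map (ρ ^ j).toHom = X j := by
  induction j with
  | zero => exact map_id (X 0)
  | succ n ih => rw [add_comm, zpow_one_add, map_aut_mul, ih, hρ, add_comm]
  | pred n ih =>
    rw [sub_eq_neg_add, zpow_add, zpow_neg_one, map_aut_mul, ih, map_aut_inv_eq_iff, hρ]
    congr 1
    ring

/-- The factors `ρ ^ j * σ * ρ ^ (-j)`, for `0 ≤ j`, of the infinite product from which an
Eilenberg swindle removes `σ` by conjugation with the shift `ρ`; trivial for `j < 0`. -/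
def shiftedCopy (ρ σ : F ≃[L] F) (j : ℤ) : F ≃[L] F :=
  if 0 ≤ j then ρ ^ j * σ * (ρ ^ j)⁻¹ else 1

section ShiftedCopy

variable {X : ℤ → L.Substructure F} {ρ σ : F ≃[L] F} {j : ℤ}

theorem shiftedCopy_of_neg (hj : j < 0) : shiftedCopy ρ σ j = 1 :=
  if_neg hj.not_ge

theorem shiftedCopy_zero : shiftedCopy ρ σ 0 = σ := by
  simp [shiftedCopy]

theorem shiftedCopy_of_pos (hj : 0 < j) :
    shiftedCopy ρ σ j = ρ * shiftedCopy ρ σ (j - 1) * ρ⁻¹ := by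
  rw [shiftedCopy, shiftedCopy, if_pos hj.le, if_pos (Int.le_sub_one_of_lt hj)]
  group

theorem map_shiftedCopy (hρ : ∀ j, (X j).map ρ.toHom = X (j + 1))
    (hσ : (X 0).map σ.toHom = X 0) (j : ℤ) : (X j).map (shiftedCopy ρ σ j).toHom = X j := by
  rw [shiftedCopy]
  split_ifs
  · have hj := map_aut_zpow hρ j
    rw [map_aut_mul, map_aut_mul, map_aut_inv_eq_iff.2 hj, hσ, hj]
  · exact map_id (X j)

theorem shiftedCopy_apply (hρ : ∀ j, (X j).map ρ.toHom = X (j + 1))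
    (hσ : (X 0).map σ.toHom = X 0) (hσ_fix : ∀ j ≠ 0, ∀ x ∈ X j, σ x = x) {x : F} (hx : x ∈ X j) :
    shiftedCopy ρ σ j x = σ (ρ (shiftedCopy ρ σ (j - 1) (ρ⁻¹ x))) := by
  rcases lt_trichotomy j 0 with hj | rfl | hj
  · rw [shiftedCopy_of_neg hj, shiftedCopy_of_neg (by lia)]
    change x = σ (ρ (ρ⁻¹ x))
    rw [aut_apply_inv_self, hσ_fix j hj.ne x hx]
  · rw [shiftedCopy_zero, shiftedCopy_of_neg (by lia)]
    exact congrArg σ (aut_apply_inv_self ρ x).symm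
  · have hmem : shiftedCopy ρ σ j x ∈ X j :=
      (map_shiftedCopy hρ hσ j).le (mem_map_of_mem (shiftedCopy ρ σ j).toHom hx)
    rw [← hσ_fix j hj.ne' _ hmem, shiftedCopy_of_pos hj]
    rfl

end ShiftedCopy

theorem IsFreeFamily.exists_eq_commutator (hb : IsFreeFamily L b) {p : ι → Option ℤ}
    {ρ σ : F ≃[L] F} (hρ_none : ∀ i, p i = none → ρ (b i) = b i)
    (hρ : ∀ j : ℤ, (span L b (p ⁻¹' {some j})).map ρ.toHom = span L b (p ⁻¹' {some (j + 1)}))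
    (hσ : σ ∈ supportedOn L b (p ⁻¹' {some 0})) :
    ∃ α ∈ supportedOn L b (p ⁻¹' {none})ᶜ, σ = α * ρ * α⁻¹ * ρ⁻¹ := by
  obtain ⟨hσ_fix, hσ_map⟩ := mem_supportedOn_iff.1 hσ
  obtain ⟨α, hα, hα_map⟩ := hb.exists_aut_glue (p := p)
    (τ := fun o => o.elim 1 (shiftedCopy ρ σ)) (Option.rec (map_id _) (map_shiftedCopy hρ hσ_map))
  have hα_none (i : ι) (hi : p i = none) : α (b i) = b i := hα none _ (mem_span hi)
  refine ⟨α, mem_supportedOn_iff.2 ⟨fun i hi => hα_none i (Set.notMem_compl_iff.1 hi),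
    hα_map {none}ᶜ⟩, ?_⟩
  suffices α = σ * (ρ * α * ρ⁻¹) by
    rw [← mul_inv_eq_iff_eq_mul.2 this]
    group
  refine hb.aut_ext fun i => ?_
  simp only [aut_mul_apply]
  rcases hi : p i with _ | j
  · have hρi : ρ⁻¹ (b i) = b i := by rw [← hρ_none i hi, aut_inv_apply_self, hρ_none i hi]
    rw [hρi, hα_none i hi, hρ_none i hi, hσ_fix i (by simp [hi])]
  · have hρi : ρ⁻¹ (b i) ∈ span L b (p ⁻¹' {some (j - 1)}) := by
      rw [← map_aut_inv_eq_iff.2 ((hρ (j - 1)).trans (by rw [sub_add_cancel]))]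
      exact mem_map_of_mem ρ⁻¹.toHom (mem_span hi)
    rw [hα (some j) _ (mem_span hi), hα (some (j - 1)) _ hρi]
    refine shiftedCopy_apply hρ hσ_map (fun k hk x hx => ?_) (mem_span hi)
    exact (mem_fixStab_iff.1 hσ).1 x (span_mono (by grind) hx)

end Swindle

section Moiety

variable {ι κ : Type*} {T T' : Set ι}

/-- A subset of `ι` that has, like its complement, the cardinality of `ι`. -/
def IsMoiety (T : Set ι) : Prop :=
  #T = #ι ∧ #(Tᶜ : Set ι) = #ι

namespace IsMoiety

theorem compl (hT : IsMoiety T) : IsMoiety Tᶜ :=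
  ⟨hT.2, (compl_compl T).symm ▸ hT.1⟩

theorem image_equiv {ι κ : Type w} {T : Set ι} (hT : IsMoiety T) (e : ι ≃ κ) :
    IsMoiety (e '' T) := by
  rw [IsMoiety, ← Set.image_compl_eq e.bijective, Cardinal.mk_image_eq e.injective,
    Cardinal.mk_image_eq e.injective, ← Cardinal.mk_congr e]
  exact hT

theorem exists_perm_image_eq (hT : IsMoiety T) (hT' : IsMoiety T') :
    ∃ π : Equiv.Perm ι, π '' T = T' := by
  classical
  obtain ⟨f⟩ := Cardinal.eq.1 (hT.1.trans hT'.1.symm)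
  obtain ⟨g⟩ := Cardinal.eq.1 (hT.2.trans hT'.2.symm)
  let π : Equiv.Perm ι := Equiv.subtypeCongr (p := (· ∈ T)) (q := (· ∈ T')) f g
  have hπ : π ⁻¹' T' = T := by
    ext i
    rw [Set.mem_preimage]
    by_cases hi : i ∈ T
    · have hπi : π i = f ⟨i, hi⟩ := by simp [π, Equiv.subtypeCongr, Equiv.sumCompl, hi]
      exact iff_of_true (hπi ▸ (f ⟨i, hi⟩).2) hi
    · have hπi : π i = g ⟨i, hi⟩ := by simp [π, Equiv.subtypeCongr, Equiv.sumCompl, hi]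
      exact iff_of_false (hπi ▸ (g ⟨i, hi⟩).2) hi
  exact ⟨π, hπ ▸ Set.image_preimage_eq T' π.surjective⟩

end IsMoiety

theorem nonempty_prod_equiv (K : Type w) [Infinite K] (X : Type) [Countable X] [Nonempty X] :
    Nonempty (K × X ≃ K) := by
  rw [← Cardinal.eq, Cardinal.mk_prod, Cardinal.lift_uzero]
  refine Cardinal.mul_eq_left (Cardinal.aleph0_le_mk K) ?_ (by simp)
  exact (Cardinal.lift_le_aleph0.2 Cardinal.mk_le_aleph0).trans (Cardinal.aleph0_le_mk K)

theorem isMoiety_snd_preimage_singleton {K : Type w} [Infinite K] {X : Type} [Countable X]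
    [Nontrivial X] (x : X) : IsMoiety (Prod.snd ⁻¹' {x} : Set (K × X)) := by
  have mk_fiber (y : X) : #K ≤ #(Prod.snd ⁻¹' {y} : Set (K × X)) :=
    Cardinal.mk_le_of_injective (f := fun k => ⟨(k, y), rfl⟩) fun k k' h =>
      congrArg (fun i => i.1.1) h
  have mk_prod : #(K × X) = #K := Cardinal.eq.2 (nonempty_prod_equiv K X)
  obtain ⟨y, hy⟩ := exists_ne x
  refine ⟨(Cardinal.mk_set_le _).antisymm (mk_prod ▸ mk_fiber x),
    (Cardinal.mk_set_le _).antisymm (mk_prod ▸ (mk_fiber y).trans (Cardinal.mk_le_mk_of_subset ?_))⟩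
  rintro i rfl
  exact hy

end Moiety

section BoundedLength

variable {L : FirstOrder.Language.{u, v}} {F : Type*} [L.Structure F] {S : Set (F ≃[L] F)}

theorem map_span_of_apply_eq_perm {ι : Type*} {b : ι → F} {π : Equiv.Perm ι} {δ : F ≃[L] F}
    (hδ : ∀ i, δ (b i) = b (π i)) (T : Set ι) :
    (span L b T).map δ.toHom = span L b (π '' T) := by
  rw [map_span, ← span_comp]
  exact span_congr fun i _ => hδ i

namespace IsFreeFamily

theorem exists_shift_forall_exists_eq_commutator {ι : Type*} {b : ι → F} (hb : IsFreeFamily L b)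
    {p : ι → Option ℤ} {shift : Equiv.Perm ι} (hp : ∀ i, p (shift i) = (p i).map (· + 1))
    (hshift : ∀ i, p i = none → shift i = i) :
    ∃ ρ ∈ supportedOn L b (p ⁻¹' {none})ᶜ, ∀ σ ∈ supportedOn L b (p ⁻¹' {some 0}),
      ∃ α ∈ supportedOn L b (p ⁻¹' {none})ᶜ, σ = α * ρ * α⁻¹ * ρ⁻¹ := by
  obtain ⟨ρ, hρ⟩ := hb.exists_aut_perm shift
  have hρ_map {A B : Set (Option ℤ)} (hAB : ∀ o : Option ℤ, o.map (· + 1) ∈ B ↔ o ∈ A) :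
      (span L b (p ⁻¹' A)).map ρ.toHom = span L b (p ⁻¹' B) := by
    have : p ⁻¹' A = shift ⁻¹' (p ⁻¹' B) := by
      ext i
      rw [Set.mem_preimage, Set.mem_preimage, Set.mem_preimage, hp, hAB]
    rw [map_span_of_apply_eq_perm hρ, this, Set.image_preimage_eq _ shift.surjective]
  have hρ_none (i : ι) (hi : p i = none) : ρ (b i) = b i := by rw [hρ, hshift i hi]
  refine ⟨ρ, mem_supportedOn_iff.2 ⟨fun i hi => hρ_none i (Set.notMem_compl_iff.1 hi),
    hρ_map (A := {none}ᶜ) (B := {none}ᶜ) (by simp)⟩, fun σ hσ => ?_⟩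
  exact hb.exists_eq_commutator hρ_none (fun j => hρ_map (by simp)) hσ

theorem exists_hasBoundedLength_supportedOn_layer {K : Type*} {b : K × ℤ × ℕ → F}
    (hb : IsFreeFamily L b) (hS : Subgroup.closure S = ⊤) :
    ∃ n : ℕ, HasBoundedLength S
      (supportedOn L b (Prod.snd ⁻¹' {((0 : ℤ), n)}) : Set (F ≃[L] F)) := by
  obtain ⟨n, hn⟩ := hb.exists_forall_mem_supportedOn_exists_length_le (fun i => i.2.2) hS
  let p : K × ℤ × ℕ → Option ℤ := fun i => if i.2.2 = n then some i.2.1 else none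
  let shift : Equiv.Perm (K × ℤ × ℕ) := (Equiv.refl K).prodCongr <|
    Equiv.prodCongrLeft fun m => if m = n then Equiv.addRight 1 else Equiv.refl ℤ
  have hp_none : (p ⁻¹' {none})ᶜ = (fun i => i.2.2) ⁻¹' {n} := by
    ext i
    simp [p]
  have hp_zero : p ⁻¹' {some 0} = Prod.snd ⁻¹' {(0, n)} := by
    ext ⟨k, j, m⟩
    simp [p, and_comm]
  obtain ⟨ρ, hρ, hcomm⟩ := hb.exists_shift_forall_exists_eq_commutator (p := p) (shift := shift)
    (fun ⟨k, j, m⟩ => by by_cases hm : m = n <;> simp [p, shift, hm])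
    (fun ⟨k, j, m⟩ hm => by simp_all [p, shift])
  rw [hp_none] at hρ hcomm
  rw [hp_zero] at hcomm
  have hρ_length : HasBoundedLength S {ρ} := .singleton hS ρ
  have hN : HasBoundedLength S {s | length S s ≤ n} := ⟨n, fun _ hs => hs⟩
  refine ⟨n, (((hN.mul hρ_length).mul hN.inv).mul hρ_length.inv).mono fun σ hσ => ?_⟩
  obtain ⟨α, hα, rfl⟩ := hcomm σ hσ
  obtain ⟨s, hs, hαs⟩ := hn α hα
  have hconj : α * ρ * α⁻¹ = s * ρ * s⁻¹ := by
    calc α * ρ * α⁻¹ = α * (ρ * (α⁻¹ * s)) * s⁻¹ := by group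
      _ = α * (α⁻¹ * s * ρ) * s⁻¹ := by rw [(hb.commute_of_mem_supportedOn hρ hαs).eq]
      _ = s * ρ * s⁻¹ := by group
  rw [hconj]
  exact Set.mul_mem_mul (Set.mul_mem_mul (Set.mul_mem_mul hs rfl) (Set.inv_mem_inv.2 hs))
    (Set.inv_mem_inv.2 rfl)

theorem hasBoundedLength_supportedOn {ι : Type*} [Infinite ι] {b : ι → F} {T : Set ι}
    (hb : IsFreeFamily L b) (hT : IsMoiety T) (hS : Subgroup.closure S = ⊤) :
    HasBoundedLength S (supportedOn L b T : Set (F ≃[L] F)) := by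
  obtain ⟨e⟩ := nonempty_prod_equiv ι (ℤ × ℕ)
  obtain ⟨n, hn⟩ := (hb.comp_equiv e).exists_hasBoundedLength_supportedOn_layer hS
  rw [supportedOn_comp] at hn
  obtain ⟨π, hπ⟩ := hT.exists_perm_image_eq
    ((isMoiety_snd_preimage_singleton (0, n)).image_equiv e)
  obtain ⟨δ, hδ⟩ := hb.exists_aut_perm π
  refine (((HasBoundedLength.singleton hS δ⁻¹).mul hn).mul (.singleton hS δ)).mono fun σ hσ => ?_
  have hconj := conj_mem_fixStab δ hσ
  rw [map_span_of_apply_eq_perm hδ, map_span_of_apply_eq_perm hδ,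
    Set.image_compl_eq π.bijective, hπ] at hconj
  refine Set.mem_mul.2 ⟨_, Set.mul_mem_mul rfl hconj, δ, rfl, ?_⟩
  group

end IsFreeFamily

end BoundedLength

section Rank

variable {L : FirstOrder.Language.{u, v}} {F : Type*} [L.Structure F] [Nontrivial F]

theorem IsIndependent.apply_notMem_span {ι : Type*} {b : ι → F} (hb : IsIndependent L b) {i : ι}
    {T : Set ι} (hi : i ∉ T) : b i ∉ span L b T := by
  classical
  intro hmem
  obtain ⟨y, hy⟩ := exists_ne (b i)
  obtain ⟨g, hg⟩ := hb (Function.update b i y)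
  have hg_fix : Set.EqOn g (Hom.id L F) (span L b T) := eqOn_span fun j hj => by
    rw [hg, Function.update_of_ne (ne_of_mem_of_not_mem hj hi), Hom.id_apply]
  refine hy ?_
  rw [← Function.update_self i y b, ← hg, hg_fix hmem, Hom.id_apply]

namespace IsFreeFamily

variable {ι κ : Type w} [Infinite ι] {b : ι → F} {c : κ → F}

theorem mk_le_mk_of_closure_range_eq_top (hc : IsFreeFamily L c)
    (hb : Substructure.closure L (Set.range b) = ⊤) : #κ ≤ #ι := by
  have hfinite (x : F) : ∃ s : Finset κ, x ∈ span L c s :=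
    exists_finset_mem_span (hc.closure_range_eq_top ▸ mem_top x)
  choose s hs using hfinite
  have hcover : ⋃ i, (s (b i) : Set κ) = Set.univ := by
    refine Set.eq_univ_of_forall fun k => ?_
    by_contra hk
    refine hc.isIndependent.apply_notMem_span hk ?_
    have hle : Substructure.closure L (Set.range b) ≤ span L c (⋃ i, (s (b i) : Set κ)) :=
      closure_le.2 <| Set.range_subset_iff.2 fun i => span_mono (Set.subset_iUnion _ i) (hs (b i))
    exact hle (hb ▸ mem_top (c k))
  calc #κ = #(⋃ i, (s (b i) : Set κ)) := by rw [hcover, Cardinal.mk_univ]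
    _ ≤ Cardinal.sum fun i => #(s (b i) : Set κ) := Cardinal.mk_iUnion_le_sum_mk
    _ ≤ Cardinal.sum fun _ : ι => ℵ₀ :=
      Cardinal.sum_le_sum _ _ fun i => (s (b i)).countable_toSet.le_aleph0
    _ = #ι := by rw [Cardinal.sum_const', Cardinal.mul_aleph0_eq (Cardinal.aleph0_le_mk ι)]

theorem mk_eq_mk [Infinite κ] (hb : IsFreeFamily L b) (hc : IsFreeFamily L c) : #ι = #κ :=
  (hb.mk_le_mk_of_closure_range_eq_top hc.closure_range_eq_top).antisymm
    (hc.mk_le_mk_of_closure_range_eq_top hb.closure_range_eq_top)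

end IsFreeFamily

end Rank

section UniversalProperties

variable {L : FirstOrder.Language.{u, v}} {E : Identities L} {F M : Type w} [L.Structure F]
  [L.Structure M] {B : Set F} {U₁ U₂ W : L.Substructure F}

theorem InVariety.of_injective {M N : Type*} [L.Structure M] [L.Structure N]
    (hN : InVariety E N) (f : M →[L] N) (hf : Function.Injective f) : InVariety E M := by
  intro e he x
  apply hf
  rw [← HomClass.realize_term, ← HomClass.realize_term]
  exact hN e he _

theorem InVariety.substructure (hF : InVariety E F) (A : L.Substructure F) : InVariety E A :=
  hF.of_injective A.subtype.toHom A.subtype.injective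

theorem InVariety.exists_equiv_max_universe (hM : InVariety E M) :
    ∃ (N : Type (max u w)) (_ : L.Structure N), InVariety E N ∧ Nonempty (M ≃[L] N) := by
  let _ : L.Structure (ULift.{u} M) := Equiv.ulift.symm.inducedStructure
  let e : M ≃[L] ULift.{u} M := Equiv.ulift.symm.inducedStructureEquiv
  exact ⟨ULift.{u} M, inferInstance, hM.of_injective e.symm.toHom e.symm.injective, ⟨e⟩⟩

theorem bijective_toHom_comp {N : Type*} [L.Structure N] (e : M ≃[L] N) :
    Function.Bijective (e.toHom.comp : (F →[L] M) → F →[L] N) := by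
  refine Function.bijective_iff_has_inverse.2 ⟨e.symm.toHom.comp, fun g => ?_, fun g => ?_⟩
  · ext x
    exact e.symm_apply_apply (g x)
  · ext x
    exact e.apply_symm_apply (g x)

theorem IsBasis.existsUnique_hom (hB : IsBasis E B) (hM : InVariety E M) (f : B → M) :
    ∃! g : F →[L] M, ∀ b : B, g b = f b := by
  obtain ⟨N, _, hN, ⟨e⟩⟩ := hM.exists_equiv_max_universe.{u}
  simpa [(bijective_toHom_comp e).existsUnique_iff] using hB.2 N hN (e ∘ f)

theorem IsFreeProduct.existsUnique_hom (h : IsFreeProduct E U₁ U₂ W) (hM : InVariety E M)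
    (f₁ : U₁ →[L] M) (f₂ : U₂ →[L] M) (f₃ : W →[L] M) :
    ∃! g : F →[L] M, (∀ x : U₁, g x = f₁ x) ∧ (∀ x : U₂, g x = f₂ x) ∧ ∀ x : W, g x = f₃ x := by
  obtain ⟨N, _, hN, ⟨e⟩⟩ := hM.exists_equiv_max_universe.{u}
  simpa [(bijective_toHom_comp e).existsUnique_iff] using
    h.2 N hN (e.toHom.comp f₁) (e.toHom.comp f₂) (e.toHom.comp f₃)

theorem eq_top_of_subtype_comp_eq_id {A : L.Substructure F} {g : F →[L] A}
    (hg : A.subtype.toHom.comp g = Hom.id L F) : A = ⊤ := by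
  refine eq_top_iff.2 fun x _ => ?_
  have hx : (g x : F) = x := DFunLike.congr_fun hg x
  exact hx ▸ (g x).2

theorem IsBasis.isFreeFamily (hB : IsBasis E B) : IsFreeFamily L ((↑) : B → F) where
  closure_range_eq_top := by
    rw [Subtype.range_coe]
    obtain ⟨g, hg, -⟩ := hB.existsUnique_hom (hB.1.substructure (Substructure.closure L B))
      fun b => ⟨b, subset_closure b.2⟩
    refine eq_top_of_subtype_comp_eq_id (g := g) ?_
    exact (hB.existsUnique_hom hB.1 (↑)).unique (fun b => congrArg Subtype.val (hg b))
      fun _ => rfl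
  isIndependent f := (hB.existsUnique_hom hB.1 f).exists

theorem IsFreeProduct.sup_eq_top (h : IsFreeProduct E U₁ U₂ W) : U₁ ⊔ U₂ ⊔ W = ⊤ := by
  have h₁ : U₁ ≤ U₁ ⊔ U₂ ⊔ W := le_sup_left.trans le_sup_left
  have h₂ : U₂ ≤ U₁ ⊔ U₂ ⊔ W := le_sup_right.trans le_sup_left
  have h₃ : W ≤ U₁ ⊔ U₂ ⊔ W := le_sup_right
  obtain ⟨g, ⟨hg₁, hg₂, hg₃⟩, -⟩ := h.existsUnique_hom (h.1.substructure (U₁ ⊔ U₂ ⊔ W))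
    (inclusion h₁).toHom (inclusion h₂).toHom (inclusion h₃).toHom
  refine eq_top_of_subtype_comp_eq_id (g := g) ?_
  refine (h.existsUnique_hom h.1 U₁.subtype.toHom U₂.subtype.toHom W.subtype.toHom).unique
    ⟨fun x => ?_, fun x => ?_, fun x => ?_⟩ ⟨fun _ => rfl, fun _ => rfl, fun _ => rfl⟩
  · exact congrArg Subtype.val (hg₁ x)
  · exact congrArg Subtype.val (hg₂ x)
  · exact congrArg Subtype.val (hg₃ x)

theorem IsFreeProduct.isFreeFamily {K : Type*} {b : K × Fin 3 → F}
    (h : IsFreeProduct E (span L b (Prod.snd ⁻¹' {0})) (span L b (Prod.snd ⁻¹' {1}))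
      (span L b (Prod.snd ⁻¹' {2})))
    (hb : ∀ i, IsIndependent L fun k => b (k, i)) : IsFreeFamily L b where
  closure_range_eq_top := by
    rw [eq_top_iff, ← h.sup_eq_top, ← span_univ]
    exact sup_le (sup_le (span_mono (Set.subset_univ _)) (span_mono (Set.subset_univ _)))
      (span_mono (Set.subset_univ _))
  isIndependent f := by
    choose g hg using fun i => hb i fun k => f (k, i)
    obtain ⟨φ, ⟨hφ₀, hφ₁, hφ₂⟩, -⟩ := h.existsUnique_hom h.1 ((g 0).domRestrict _)
      ((g 1).domRestrict _) ((g 2).domRestrict _)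
    have hφ (i : Fin 3) (k : K) : φ (b (k, i)) = g i (b (k, i)) := by
      fin_cases i
      · exact hφ₀ ⟨_, mem_span rfl⟩
      · exact hφ₁ ⟨_, mem_span rfl⟩
      · exact hφ₂ ⟨_, mem_span rfl⟩
    exact ⟨φ, fun ⟨k, i⟩ => (hφ i k).trans (hg i k)⟩

theorem hom_ext_span {ι M : Type*} [L.Structure M] {b : ι → F} {T : Set ι}
    {f g : span L b T →[L] M} (h : ∀ i (hi : i ∈ T), f ⟨b i, mem_span hi⟩ = g ⟨b i, mem_span hi⟩) :
    f = g := by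
  have hle : span L b T ≤ (f.eqLocus g).map (span L b T).subtype.toHom :=
    closure_le.2 (Set.forall_mem_image.2 fun i hi => ⟨⟨b i, mem_span hi⟩, h i hi, rfl⟩)
  ext x
  obtain ⟨y, hy, hyx⟩ := hle x.2
  exact (Subtype.ext hyx : y = x) ▸ hy

theorem IsBasis.isFreeProduct (hB : IsBasis E B) (p : B → Fin 3) :
    IsFreeProduct E (span L ((↑) : B → F) (p ⁻¹' {0})) (span L ((↑) : B → F) (p ⁻¹' {1}))
      (span L ((↑) : B → F) (p ⁻¹' {2})) := by
  refine ⟨hB.1, fun M _ hM f₀ f₁ f₂ => ?_⟩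
  let f : ∀ i, span L ((↑) : B → F) (p ⁻¹' {i}) →[L] M
    | 0 => f₀
    | 1 => f₁
    | 2 => f₂
  have hall (g : F →[L] M) :
      (∀ b : B, g b = f (p b) ⟨b, mem_span rfl⟩) ↔ ∀ i, g.domRestrict _ = f i := by
    constructor
    · intro hg i
      refine hom_ext_span ?_
      rintro b rfl
      exact hg b
    · exact fun hg b => DFunLike.congr_fun (hg (p b)) ⟨b, mem_span rfl⟩
  have hg := hB.2 M hM fun b => f (p b) ⟨b, mem_span rfl⟩
  simp only [hall] at hg
  simpa [Fin.forall_fin_succ, f, DFunLike.ext_iff] using hg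

end UniversalProperties

section Factorizations

variable {L : FirstOrder.Language.{u, v}} {E : Identities L} {F : Type w} [L.Structure F]
  {B : Set F} {U U₁ U₂ W : L.Substructure F}

theorem mk_eq_of_mk_eq_mk_diff {α : Type*} {s t : Set α} (hs : s.Infinite) (ht : t ⊆ s)
    (h : #t = #(s \ t : Set α)) : #t = #s := by
  have hsum : #t + #t = #s := by
    rw [← Cardinal.mk_sdiff_add_mk ht, ← h]
  have ht_infinite : ℵ₀ ≤ #t := by
    by_contra! hlt
    refine (Cardinal.add_lt_aleph0 hlt hlt).not_ge ?_
    rw [hsum]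
    exact Cardinal.aleph0_le_mk_iff.2 hs.to_subtype
  rwa [Cardinal.add_eq_self ht_infinite] at hsum

theorem IsMoietous.exists_isIndependent (hU : IsMoietous E U) (hB : IsBasis E B)
    (hB_infinite : B.Infinite) :
    ∃ c : B → F, IsIndependent L c ∧ Substructure.closure L (Set.range c) = U := by
  obtain ⟨C, hC, hC_infinite, J, hJC, hJ, rfl⟩ := hU
  have : Infinite B := hB_infinite.to_subtype
  have : Infinite C := hC_infinite.to_subtype
  have : Infinite F := Infinite.of_injective _ (Subtype.val_injective (p := (· ∈ B)))
  have hBJ : #B = #J :=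
    (hB.isFreeFamily.mk_eq_mk hC.isFreeFamily).trans
      (mk_eq_of_mk_eq_mk_diff hC_infinite hJC hJ).symm
  obtain ⟨e⟩ := Cardinal.eq.1 hBJ
  refine ⟨fun k => e k, ?_, ?_⟩
  · exact hC.isFreeFamily.isIndependent.comp ((Set.inclusion_injective hJC).comp e.injective)
  · exact congrArg _ ((e.surjective.range_comp _).trans Subtype.range_coe)

theorem span_snd_preimage_singleton {K X : Type*} (b : K × X → F) (x : X) :
    span L b (Prod.snd ⁻¹' {x}) = Substructure.closure L (Set.range fun k => b (k, x)) := by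
  rw [span]
  congr 1
  ext
  simp

theorem IsMoietousFactorization.exists_isFreeFamily (h : IsMoietousFactorization E U₁ U₂ W) :
    ∃ (K : Type w) (_ : Infinite K) (b : K × Fin 3 → F), IsFreeFamily L b ∧
      U₁ = span L b (Prod.snd ⁻¹' {0}) ∧ U₂ = span L b (Prod.snd ⁻¹' {1}) ∧
      W = span L b (Prod.snd ⁻¹' {2}) := by
  obtain ⟨hU₁, hU₂, hW, hfree⟩ := h
  obtain ⟨B, hB, hB_infinite, -⟩ := id hU₁
  obtain ⟨c₀, hc₀, rfl⟩ := hU₁.exists_isIndependent hB hB_infinite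
  obtain ⟨c₁, hc₁, rfl⟩ := hU₂.exists_isIndependent hB hB_infinite
  obtain ⟨c₂, hc₂, rfl⟩ := hW.exists_isIndependent hB hB_infinite
  let b : B × Fin 3 → F := fun i => ![c₀, c₁, c₂] i.2 i.1
  have h₀ := span_snd_preimage_singleton (L := L) b 0
  have h₁ := span_snd_preimage_singleton (L := L) b 1
  have h₂ := span_snd_preimage_singleton (L := L) b 2
  refine ⟨B, hB_infinite.to_subtype, b, ?_, h₀.symm, h₁.symm, h₂.symm⟩
  refine IsFreeProduct.isFreeFamily (E := E) (by rwa [h₀, h₁, h₂]) fun i => ?_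
  fin_cases i
  exacts [hc₀, hc₁, hc₂]

theorem IsMoietousFactorization.hasBoundedLength_macphersonSet
    (h : IsMoietousFactorization E U₁ U₂ W) {S : Set (F ≃[L] F)} (hS : Subgroup.closure S = ⊤) :
    HasBoundedLength S (macphersonSet U₁ U₂ W) := by
  obtain ⟨K, _, b, hb, rfl, rfl, rfl⟩ := h.exists_isFreeFamily
  have hbound (i : Fin 3) : HasBoundedLength S
      (supportedOn L b (Prod.snd ⁻¹' {i})ᶜ : Set (F ≃[L] F)) :=
    hb.hasBoundedLength_supportedOn (isMoiety_snd_preimage_singleton i).compl hS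
  have hcompl {i j k : Fin 3} (hijk : ({i}ᶜ : Set (Fin 3)) = {j} ∪ {k}) :
      supportedOn L b (Prod.snd ⁻¹' {i})ᶜ = fixStab (span L b (Prod.snd ⁻¹' {i}))
        (span L b (Prod.snd ⁻¹' {j}) ⊔ span L b (Prod.snd ⁻¹' {k})) := by
    rw [supportedOn, compl_compl, ← Set.preimage_compl, hijk, Set.preimage_union, span_union]
  rw [macphersonSet, ← hcompl (by ext i; fin_cases i <;> simp),
    ← hcompl (by ext i; fin_cases i <;> simp)]
  exact (hbound 1).union (hbound 0)

theorem IsMoietousFactorization.width_macphersonSet_ne_top_iff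
    (h : IsMoietousFactorization E U₁ U₂ W) :
    width (macphersonSet U₁ U₂ W) ≠ ⊤ ↔
      Subgroup.closure (macphersonSet U₁ U₂ W) = ⊤ ∧ UniversallyFiniteWidth (F ≃[L] F) := by
  refine ⟨fun hw => ⟨closure_eq_top_of_width_ne_top hw, fun S hS => ?_⟩, fun hG => hG.2 _ hG.1⟩
  rw [width_ne_top_iff_hasBoundedLength] at hw ⊢
  exact hw.trans (h.hasBoundedLength_macphersonSet hS)

theorem IsBasis.isMoietous_span (hB : IsBasis E B) (hB_infinite : B.Infinite) {T : Set B}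
    (hT : IsMoiety T) : IsMoietous E (span L ((↑) : B → F) T) := by
  refine ⟨B, hB, hB_infinite, (↑) '' T, Subtype.coe_image_subset B T, ?_, rfl⟩
  have hdiff : B \ (↑) '' T = (↑) '' (Tᶜ : Set B) := by
    rw [Set.image_compl_eq_range_sdiff_image Subtype.val_injective, Subtype.range_coe]
  rw [hdiff, Cardinal.mk_image_eq Subtype.val_injective,
    Cardinal.mk_image_eq Subtype.val_injective, hT.1, hT.2]

theorem exists_isMoietousFactorization (hF : IsFreeOfInfiniteRank E F) :
    ∃ U₁ U₂ W : L.Substructure F, IsMoietousFactorization E U₁ U₂ W := by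
  obtain ⟨B, hB, hB_infinite⟩ := hF
  have : Infinite B := hB_infinite.to_subtype
  obtain ⟨e⟩ := nonempty_prod_equiv B (Fin 3)
  let p : B → Fin 3 := fun b => (e.symm b).2
  have hp (i : Fin 3) : IsMoietous E (span L ((↑) : B → F) (p ⁻¹' {i})) := by
    have hfiber : p ⁻¹' {i} = e '' (Prod.snd ⁻¹' {i}) :=
      (e.image_eq_preimage_symm (Prod.snd ⁻¹' {i})).symm
    exact hB.isMoietous_span hB_infinite
      (hfiber ▸ (isMoiety_snd_preimage_singleton i).image_equiv e)
  exact ⟨_, _, _, hp 0, hp 1, hp 2, hB.isFreeProduct p⟩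

end Factorizations

end BMN

theorem mainTheorem3_general {L : FirstOrder.Language.{u, v}} (E : BMN.Identities L) (F : Type w)
    [L.Structure F] (hF : BMN.IsFreeOfInfiniteRank E F)
    (hE : ∀ U₁ U₂ W : L.Substructure F, BMN.IsMoietousFactorization E U₁ U₂ W →
      Subgroup.closure (BMN.macphersonSet U₁ U₂ W) = ⊤) :
    (BMN.UniversallyFiniteWidth (F ≃[L] F) ↔
      ∃ U₁ U₂ W : L.Substructure F, BMN.IsMoietousFactorization E U₁ U₂ W ∧
        BMN.width (BMN.macphersonSet U₁ U₂ W) ≠ ⊤) ∧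
    (∀ U₁ U₂ W : L.Substructure F, BMN.IsMoietousFactorization E U₁ U₂ W →
      (BMN.UniversallyFiniteWidth (F ≃[L] F) ↔
        BMN.width (BMN.macphersonSet U₁ U₂ W) ≠ ⊤)) := by
  have width_ne_top_iff (U₁ U₂ W : L.Substructure F) (h : BMN.IsMoietousFactorization E U₁ U₂ W) :
      BMN.UniversallyFiniteWidth (F ≃[L] F) ↔ BMN.width (BMN.macphersonSet U₁ U₂ W) ≠ ⊤ := by
    rw [h.width_macphersonSet_ne_top_iff, and_iff_right (hE U₁ U₂ W h)]
  refine ⟨⟨fun hG => ?_, ?_⟩, width_ne_top_iff⟩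
  · obtain ⟨U₁, U₂, W, h⟩ := BMN.exists_isMoietousFactorization hF
    exact ⟨U₁, U₂, W, h, (width_ne_top_iff U₁ U₂ W h).1 hG⟩
  · rintro ⟨U₁, U₂, W, h, hw⟩
    exact (width_ne_top_iff U₁ U₂ W h).2 hw

theorem mainTheorem3 {L : FirstOrder.Language.{u, v}} [L.IsAlgebraic] (E : BMN.Identities L)
    (hE : BMN.IsBMNVariety.{u, v, w} E) (F : Type w) [L.Structure F]
    (hF : BMN.IsFreeOfInfiniteRank E F) :
    (BMN.UniversallyFiniteWidth (F ≃[L] F) ↔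
      ∃ U₁ U₂ W : L.Substructure F, BMN.IsMoietousFactorization E U₁ U₂ W ∧
        BMN.width (BMN.macphersonSet U₁ U₂ W) ≠ ⊤) ∧
    (∀ U₁ U₂ W : L.Substructure F, BMN.IsMoietousFactorization E U₁ U₂ W →
      (BMN.UniversallyFiniteWidth (F ≃[L] F) ↔
        BMN.width (BMN.macphersonSet U₁ U₂ W) ≠ ⊤)) :=
  mainTheorem3_general E F hF (hE F hF)
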